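/- Let $k$ be an algebraically closed field, let $V$ be a $k$-vector space of dimension $n+1$, and let $E=\bigwedge V$ be its exterior algebra, graded so that $V$ has degree $1$. A graded left $E$-module $P=\bigoplus_i P_i$ with top degree $c=\max\{i : P_i\neq 0\}$ is called *faithful* if for every nonzero $v\in V$ the sequence of multiplications by $v$ $$\cdots\longrightarrow P_{i-1}\xrightarrow{\;\cdot v\;}P_i\xrightarrow{\;\cdot v\;}P_{i+1}\longrightarrow\cdots$$ is exact at $P_i$ for all $i<c$ (the zero module counts as faithful). Let $P=\bigoplus_{i\ge 0}P_i$ be a finitely generated faithful graded left $E$-module, $P\ne 0$, let $l=\max\{i : P_i\neq 0\}$, and put $$\chi_l=\sum_{j=0}^{l}(-1)^{l-j}\dim_k P_j .$$ Assume $\chi_l\geq n$, and let $r$ be an integer with $0\le r\le \chi_l-n$. Then for a general $r$-dimensional subspace $L\subset P_l$, that is, for all $L$ in some nonempty Zariski open subset of the Grassmannian $\mathrm{Gr}(r,P_l)$, the quotient $P/L$, graded by the images of the $P_i$, is a faithful graded $E$-module. (Such an $L$ is an $E$-submodule of $P$, since $V\cdot P_l=0$.) -/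

import Mathlib

open Module

section GradedModules

/-- `𝒢` makes the left module `P` over `E = ⋀ V` a `ℤ`-graded module: `P = ⨁ i, 𝒢 i`, and
`E_a • P_i ⊆ P_{a+i}`, where `V` has degree `1` in `E`. -/
structure IsGradedExteriorModule {K : Type*} [Field K] (V : Type*) [AddCommGroup V] [Module K V]
    {P : Type*} [AddCommGroup P] [Module K P] [Module (ExteriorAlgebra K V) P]
    (𝒢 : ℤ → Submodule K P) : Prop where
  isInternal : DirectSum.IsInternal 𝒢
  smul_mem : ∀ (a : ℕ) (i : ℤ) (x : ExteriorAlgebra K V) (p : P),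
    x ∈ ⋀[K]^a V → p ∈ 𝒢 i → x • p ∈ 𝒢 (a + i)

/-- A graded `⋀ V`-module is faithful if, for every nonzero `v : V`, the sequence
`⋯ → P_{i-1} → P_i → P_{i+1} → ⋯` of multiplications by `v` is exact at `P_i` for all `i < c`,
where `c` is the top degree of `P`. (`∃ j, i < j ∧ 𝒢 j ≠ ⊥` says `i < c`.) -/
structure IsFaithfulExteriorModule {K : Type*} [Field K] (V : Type*) [AddCommGroup V] [Module K V]
    {P : Type*} [AddCommGroup P] [Module K P] [Module (ExteriorAlgebra K V) P]
    (𝒢 : ℤ → Submodule K P) : Prop extends IsGradedExteriorModule V 𝒢 where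
  exact : ∀ v : V, v ≠ 0 → ∀ i : ℤ, (∃ j, i < j ∧ 𝒢 j ≠ ⊥) → ∀ p ∈ 𝒢 i,
    (ExteriorAlgebra.ι K v • p = 0 ↔ ∃ q ∈ 𝒢 (i - 1), ExteriorAlgebra.ι K v • q = p)

/-- `χ_l = ∑_{j=0}^{l} (-1)^{l-j} dim P_j`. -/
noncomputable def alternatingDim {K : Type*} [Field K] {P : Type*} [AddCommGroup P] [Module K P]
    (𝒢 : ℤ → Submodule K P) (l : ℤ) : ℤ :=
  ∑ j ∈ Finset.Icc 0 l, ((l - j).negOnePow : ℤ) * (finrank K (𝒢 j) : ℤ)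

/-- The `⋀ V`-submodule of `P` generated by a subspace `L` of the graded piece `𝒢 l`. When `l` is
the top degree it is `L` itself, see `restrictScalars_pieceSpan`. -/
def pieceSpan {K : Type*} [Field K] (V : Type*) [AddCommGroup V] [Module K V]
    {P : Type*} [AddCommGroup P] [Module K P] [Module (ExteriorAlgebra K V) P]
    {𝒢 : ℤ → Submodule K P} {l : ℤ} (L : Submodule K (𝒢 l)) :
    Submodule (ExteriorAlgebra K V) P :=
  Submodule.span (ExteriorAlgebra K V) (L.map (𝒢 l).subtype : Set P)

theorem restrictScalars_pieceSpan {K : Type*} [Field K] {V : Type*} [AddCommGroup V] [Module K V]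
    {P : Type*} [AddCommGroup P] [Module K P] [Module (ExteriorAlgebra K V) P]
    [IsScalarTower K (ExteriorAlgebra K V) P] {𝒢 : ℤ → Submodule K P}
    (h : IsGradedExteriorModule V 𝒢) {l : ℤ} (hl : IsGreatest {i | 𝒢 i ≠ ⊥} l)
    (L : Submodule K (𝒢 l)) :
    (pieceSpan V L).restrictScalars K = L.map (𝒢 l).subtype := by
  have hbot : 𝒢 (1 + l) = ⊥ := by
    by_contra hne
    have := hl.2 hne
    omega
  have key : ∀ x : ExteriorAlgebra K V, ∀ p ∈ L.map (𝒢 l).subtype,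
      x • p ∈ L.map (𝒢 l).subtype := by
    intro x
    induction x using ExteriorAlgebra.induction with
    | algebraMap r =>
      intro p hp
      rw [algebraMap_smul]
      exact Submodule.smul_mem _ _ hp
    | ι v =>
      intro p hp
      have hpl : p ∈ 𝒢 l := by
        obtain ⟨q, -, rfl⟩ := hp
        exact q.2
      have h1 : ExteriorAlgebra.ι K v ∈ ⋀[K]^1 V := by
        change _ ∈ LinearMap.range (ExteriorAlgebra.ι K) ^ 1
        rw [pow_one]
        exact LinearMap.mem_range_self _ v
      have h2 := h.smul_mem 1 l _ p h1 hpl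
      rw [Nat.cast_one, hbot, Submodule.mem_bot] at h2
      rw [h2]
      exact Submodule.zero_mem _
    | mul a b ha hb =>
      intro p hp
      rw [mul_smul]
      exact ha _ (hb _ hp)
    | add a b ha hb =>
      intro p hp
      rw [add_smul]
      exact Submodule.add_mem _ (ha _ hp) (hb _ hp)
  apply le_antisymm
  · intro p hp
    have hp' : p ∈ Submodule.span (ExteriorAlgebra K V) (L.map (𝒢 l).subtype : Set P) := hp
    induction hp' using Submodule.span_induction with
    | mem x hx => exact hx
    | zero => exact Submodule.zero_mem _
    | add x y hx hy ihx ihy => exact Submodule.add_mem _ (ihx hx) (ihy hy)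
    | smul a x hx ih => exact key a _ (ih hx)
  · intro p hp
    exact Submodule.subset_span hp

/-- The grading induced on a quotient: `(P / N)_i` is the image of `P_i`. -/
def quotientGrading {K : Type*} [Field K] {V : Type*} [AddCommGroup V] [Module K V]
    {P : Type*} [AddCommGroup P] [Module K P] [Module (ExteriorAlgebra K V) P]
    [IsScalarTower K (ExteriorAlgebra K V) P]
    (𝒢 : ℤ → Submodule K P) (N : Submodule (ExteriorAlgebra K V) P) : ℤ → Submodule K (P ⧸ N) :=
  fun i => (𝒢 i).map (N.mkQ.restrictScalars K)

end GradedModules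

section Grassmannian

/-- The Grassmannian `Gr(r, W)` of `r`-dimensional subspaces of `W`. -/
def Gr (K : Type*) [Field K] (r : ℕ) (W : Type*) [AddCommGroup W] [Module K W] : Type _ :=
  {L : Submodule K W // finrank K L = r}

/-- The Zariski topology on `W ^ r`, for a finite-dimensional vector space `W`: its basic open sets
are the nonvanishing loci of polynomials in the linear coordinates `w ↦ φ (w i)`. -/
@[reducible] def zariskiPi (K : Type*) [Field K] (r : ℕ) (W : Type*) [AddCommGroup W] [Module K W] :
    TopologicalSpace (Fin r → W) :=
  TopologicalSpace.generateFrom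
    {U | ∃ f : MvPolynomial (Fin r × Dual K W) K,
      U = {w | MvPolynomial.eval (fun x => x.2 (w x.1)) f ≠ 0}}

/-- The surjection from `r`-frames (linearly independent families) in `W` to `Gr(r, W)`. -/
noncomputable def frameSpan (K : Type*) [Field K] (r : ℕ) (W : Type*) [AddCommGroup W]
    [Module K W] (w : {w : Fin r → W // LinearIndependent K w}) : Gr K r W :=
  ⟨Submodule.span K (Set.range w.1), by simpa using finrank_span_eq_card w.2⟩

/-- The Zariski topology on `Gr(r, W)`, as the quotient topology of the (Zariski open) variety of
`r`-frames in `W ^ r`. -/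
@[reducible] noncomputable def zariskiGr (K : Type*) [Field K] (r : ℕ) (W : Type*) [AddCommGroup W] [Module K W] :
    TopologicalSpace (Gr K r W) :=
  TopologicalSpace.coinduced (frameSpan K r W)
    (TopologicalSpace.induced Subtype.val (zariskiPi K r W))

/-- A general `r`-dimensional subspace of `W` satisfies `Q`: some nonempty Zariski open subset of
the (irreducible) variety `Gr(r, W)` consists of subspaces satisfying `Q`. -/
def ForGeneralSubspace (K : Type*) [Field K] (r : ℕ) (W : Type*) [AddCommGroup W] [Module K W]
    (Q : Submodule K W → Prop) : Prop :=
  ∃ U : Set (Gr K r W), (zariskiGr K r W).IsOpen U ∧ U.Nonempty ∧ ∀ L ∈ U, Q L.1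

end Grassmannian

/-! Exactness below degree `l` and rank-nullity give `v : P_{l-1} → P_l` the same rank `s = dim P_l
- χ_l` for every nonzero `v` (`IsFaithfulExteriorModule.finrank_map_extMul`). The quotient `P/L`
stays faithful as soon as `L` meets each of these images only in `0`
(`IsFaithfulExteriorModule.quotientGrading_pieceSpan`), so it suffices that a general `L` does.

This is a dimension count with `d = dim P_l`. A bad `r`-tuple is determined by `v` up to scale (`n`
parameters), a relation `a` up to scale (`r - 1`), a point of the image (`s`) and the other `r - 1`
vectors (`(r - 1) * d`). The total is less than `r * d` exactly when `n + r + s ≤ d`, that is `r ≤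
χ_l - n`. Transcendence degree then replaces dimension theory: a polynomial map from fewer
parameters satisfies a nonzero equation `F`, and the locus `F ≠ 0` yields the open subset of the
Grassmannian. -/

/-- More polynomials than variables satisfy a nontrivial polynomial relation. -/
theorem MvPolynomial.exists_ne_zero_eval_eq_zero_of_card_lt {K σ τ : Type*} [Field K] [Fintype σ]
    [Fintype τ] (h : Fintype.card τ < Fintype.card σ) (g : σ → MvPolynomial τ K) :
    ∃ F : MvPolynomial σ K, F ≠ 0 ∧
      ∀ x : τ → K, MvPolynomial.eval (fun i => MvPolynomial.eval x (g i)) F = 0 := by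
  have hg : ¬ AlgebraicIndependent K g := by
    intro hg
    have := hg.lift_cardinalMk_le_trdeg
    simp only [MvPolynomial.trdeg_of_isDomain, Cardinal.mk_fintype, Cardinal.lift_natCast,
      Nat.cast_le] at this
    omega
  rw [algebraicIndependent_iff] at hg
  push Not at hg
  obtain ⟨F, hF, hF0⟩ := hg
  refine ⟨F, hF0, fun x => ?_⟩
  have := congrArg (MvPolynomial.eval x) hF
  rw [map_zero, MvPolynomial.aeval_def, ← MvPolynomial.coe_eval₂Hom] at this
  rw [← this, ← RingHom.comp_apply]
  congr 1
  ext <;> simp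

/-! ### Hypersurfaces containing the bad tuples -/

section DimensionCount

variable {K V U W κ δ : Type*} [Field K] [AddCommGroup V] [Module K V] [AddCommGroup U]
  [Module K U] [AddCommGroup W] [Module K W] [Fintype δ] {n r s : ℕ}

/-- One affine chart of the bad locus: `v` and `a` are scaled to have a coordinate `1`, and the
point of the image is a combination of `m v (u t)` for fixed vectors `u t`. The relation can then be
solved for `w i₀` polynomially in the remaining data. -/
theorem exists_polynomial_vanishing_on_chart (m : V →ₗ[K] U →ₗ[K] W)
    (bV : Basis (Fin (n + 1)) K V) (bW : Basis δ K W)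
    (hd : n + r + s ≤ Fintype.card δ) (j₀ : Fin (n + 1)) (i₀ : Fin r) (u : Fin s → U) :
    ∃ F : MvPolynomial (Fin r × δ) K, F ≠ 0 ∧ ∀ (w : Fin r → W) (v : V) (a : Fin r → K)
      (c : Fin s → K), bV.repr v j₀ = 1 → a i₀ = 1 →
      ∑ i, a i • w i = ∑ t, c t • m v (u t) →
      MvPolynomial.eval (fun x => bW.repr (w x.1) x.2) F = 0 := by
  classical
  -- The free parameters: the other coordinates of `v`, the other entries of `a`, the coefficients
  -- `c`, and the coordinates of the `w i` with `i ≠ i₀`.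
  let τ := {j // j ≠ j₀} ⊕ {i // i ≠ i₀} ⊕ Fin s ⊕ ({i // i ≠ i₀} × δ)
  let vp : Fin (n + 1) → MvPolynomial τ K := fun j =>
    if h : j = j₀ then 1 else MvPolynomial.X (Sum.inl ⟨j, h⟩)
  let g : Fin r × δ → MvPolynomial τ K := fun x =>
    if h : x.1 = i₀ then
      ∑ t, ∑ j, MvPolynomial.X (Sum.inr (Sum.inr (Sum.inl t))) * vp j *
        MvPolynomial.C (bW.repr (m (bV j) (u t)) x.2) -
      ∑ i : {i // i ≠ i₀}, MvPolynomial.X (Sum.inr (Sum.inl i)) *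
        MvPolynomial.X (Sum.inr (Sum.inr (Sum.inr (i, x.2))))
    else MvPolynomial.X (Sum.inr (Sum.inr (Sum.inr (⟨x.1, h⟩, x.2))))
  have hcard : Fintype.card τ < Fintype.card (Fin r × δ) := by
    obtain ⟨r', rfl⟩ : ∃ r', r = r' + 1 := ⟨r - 1, by have := i₀.pos; omega⟩
    simp only [τ, ne_eq, Fintype.card_sum, Fintype.card_subtype_compl, Fintype.card_fin,
      Fintype.card_unique, Fintype.card_prod, Nat.add_sub_cancel]
    rw [add_mul]
    omega
  obtain ⟨F, hF0, hF⟩ := MvPolynomial.exists_ne_zero_eval_eq_zero_of_card_lt hcard g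
  refine ⟨F, hF0, fun w v a c hv ha h => ?_⟩
  let x : τ → K := Sum.elim (fun j => bV.repr v j) (Sum.elim (fun i => a i)
    (Sum.elim c fun y => bW.repr (w y.1) y.2))
  have hvp : ∀ j, MvPolynomial.eval x (vp j) = bV.repr v j := by
    intro j
    by_cases hj : j = j₀
    · subst hj; simp [vp, hv]
    · simp [vp, hj, x]
  have hx := hF x
  convert hx using 3
  funext y
  obtain ⟨i, k⟩ := y
  by_cases hi : i = i₀
  · subst hi
    have h1 : w i = ∑ t, c t • m v (u t) - ∑ i' : {i' // i' ≠ i}, a i' • w i' := by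
      rw [← h, Fintype.sum_eq_add_sum_subtype_ne _ i, ha, one_smul, add_sub_cancel_right]
    have h2 : ∀ t, m v (u t) = ∑ j, bV.repr v j • m (bV j) (u t) := by
      intro t
      conv_lhs => rw [← bV.sum_repr v]
      simp only [map_sum, map_smul, LinearMap.sum_apply, LinearMap.smul_apply]
    simp only [g, dite_true, map_sub, map_sum, map_mul, hvp, MvPolynomial.eval_X,
      MvPolynomial.eval_C]
    rw [h1]
    simp [h2, x, Finset.mul_sum, mul_assoc]
  · simp [g, hi, x]

/-- If the nonzero members of a linear family of maps `U → W` parametrized by `V` have rank `s`,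
then the `r`-tuples in `W` with a nontrivial combination in the image of some nonzero member lie
on a hypersurface, as soon as `dim V - 1 + r + s ≤ dim W`. -/
theorem exists_polynomial_of_rank [Module.Finite K U] (m : V →ₗ[K] U →ₗ[K] W)
    (bV : Basis (Fin (n + 1)) K V) (bW : Basis δ K W)
    (hd : n + r + s ≤ Fintype.card δ)
    (hs : ∀ v, v ≠ 0 → finrank K (LinearMap.range (m v)) = s) :
    ∃ F : MvPolynomial (Fin r × δ) K, F ≠ 0 ∧ ∀ (w : Fin r → W) (v : V) (a : Fin r → K),
      v ≠ 0 → a ≠ 0 → ∑ i, a i • w i ∈ LinearMap.range (m v) →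
      MvPolynomial.eval (fun x => bW.repr (w x.1) x.2) F = 0 := by
  classical
  let bU := Module.finBasis K U
  -- A chart fixes the normalised coordinates of `v` and `a` and the `s` basis vectors of `U` whose
  -- images form a basis of the range. There are finitely many, so the product of their equations
  -- works.
  choose F hF0 hF using fun y : Fin (n + 1) × Fin r × (Fin s → Fin (finrank K U)) =>
    exists_polynomial_vanishing_on_chart m bV bW hd y.1 y.2.1 (bU ∘ y.2.2)
  refine ⟨∏ y, F y, Finset.prod_ne_zero_iff.2 fun y _ => hF0 y, fun w v a hv ha h => ?_⟩
  obtain ⟨j, hj⟩ : ∃ j, bV.repr v j ≠ 0 := by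
    by_contra! hc
    exact hv (bV.repr.map_eq_zero_iff.1 (Finsupp.ext hc))
  obtain ⟨i, hi⟩ : ∃ i, a i ≠ 0 := by
    by_contra! hc
    exact ha (funext hc)
  have hspan : Submodule.span K (Set.range (m v ∘ bU)) = LinearMap.range (m v) := by
    rw [Set.range_comp, ← Submodule.map_span, bU.span_eq, LinearMap.range_eq_map]
  have : Module.Finite K (Submodule.span K (Set.range (m v ∘ bU))) :=
    Module.Finite.span_of_finite K (Set.finite_range _)
  obtain ⟨f, hfmem, hfspan, -⟩ :=
    Submodule.exists_fun_fin_finrank_span_eq K (Set.range (m v ∘ bU))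
  have hfin : finrank K (Submodule.span K (Set.range (m v ∘ bU))) = s := by rw [hspan, hs v hv]
  replace hfspan := hfspan.trans hspan
  revert f
  rw [hfin]
  intro f hfmem hfspan
  choose S hS using hfmem
  -- The scalars multiply to `(a i)⁻¹`, which normalises `a`. Dividing `v` by its coordinate is
  -- offset below by multiplying `c` by it.
  have h' : (bV.repr v j * (a i)⁻¹) • (bV.repr v j)⁻¹ • ∑ i, a i • w i ∈
      Submodule.span K (Set.range f) := by
    rw [hfspan]
    exact Submodule.smul_mem _ _ (Submodule.smul_mem _ _ h)
  obtain ⟨c, hc⟩ := (Submodule.mem_span_range_iff_exists_fun K).1 h'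
  rw [map_prod]
  refine Finset.prod_eq_zero (Finset.mem_univ (j, i, S)) ?_
  refine hF (j, i, S) w ((bV.repr v j)⁻¹ • v) ((a i)⁻¹ • a) (fun t => bV.repr v j * c t)
    (by simp [hj]) (by simp [hi]) ?_
  have e1 : ∀ t, (bV.repr v j * c t) • m ((bV.repr v j)⁻¹ • v) (bU (S t)) = c t • f t := by
    intro t
    rw [← hS t, map_smul, LinearMap.smul_apply, smul_smul]
    congr 1
    field_simp
  simp only [Function.comp_apply, e1]
  rw [hc, smul_smul, Finset.smul_sum]
  refine Finset.sum_congr rfl fun k _ => ?_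
  simp only [Pi.smul_apply, smul_eq_mul, smul_smul]
  congr 1
  field_simp

end DimensionCount

/-! ### From a hypersurface to an open set in the Grassmannian -/

section General

variable {K W : Type*} [Field K] [AddCommGroup W] [Module K W] {r : ℕ}

/-- A property of subspaces that holds for all spans of frames outside a hypersurface is general. -/
theorem ForGeneralSubspace.of_polynomial [Infinite K] {δ : Type*} [Fintype δ]
    (bW : Basis δ K W) (F : MvPolynomial (Fin r × δ) K) (hF : F ≠ 0) (Q : Submodule K W → Prop)
    (hli : ∀ w : Fin r → W, MvPolynomial.eval (fun x => bW.repr (w x.1) x.2) F ≠ 0 →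
      LinearIndependent K w)
    (hQ : ∀ w : Fin r → W, MvPolynomial.eval (fun x => bW.repr (w x.1) x.2) F ≠ 0 →
      Q (Submodule.span K (Set.range w))) :
    ForGeneralSubspace K r W Q := by
  classical
  let O : Set (Fin r → W) := {w | MvPolynomial.eval (fun x => bW.repr (w x.1) x.2) F ≠ 0}
  refine ⟨{L | ∃ w ∈ O, Submodule.span K (Set.range w) = L.1}, ?_, ?_, ?_⟩
  · let T (A : Matrix (Fin r) (Fin r) K) (w : Fin r → W) : Fin r → W := fun i => ∑ j, A i j • w j
    -- A frame spans a member of the set iff some matrix `A` carries it into `O`, since tuples in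
    -- `O` are independent and so keep the span. Each condition is the nonvanishing of `F` after a
    -- linear substitution.
    have hO : (zariskiPi K r W).IsOpen (⋃ A, {w | T A w ∈ O}) := by
      refine @isOpen_iUnion _ _ (zariskiPi K r W) _ fun A => ?_
      refine TopologicalSpace.isOpen_generateFrom_of_mem
        ⟨MvPolynomial.bind₁ (fun x : Fin r × δ => ∑ j, MvPolynomial.C (A x.1 j) *
          MvPolynomial.X (j, bW.coord x.2)) F, ?_⟩
      ext w
      simp only [Set.mem_ofPred_eq, O, T]
      rw [← MvPolynomial.coe_aeval_eq_eval, ← MvPolynomial.coe_aeval_eq_eval]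
      simp only [RingHom.coe_coe, MvPolynomial.aeval_bind₁]
      simp [Finsupp.finsetSum_apply]
    refine ⟨_, hO, ?_⟩
    ext w
    constructor
    · intro hw
      obtain ⟨A, hA⟩ := Set.mem_iUnion.1 hw
      refine ⟨T A w.1, hA, ?_⟩
      have hle : Submodule.span K (Set.range (T A w.1)) ≤ Submodule.span K (Set.range w.1) := by
        rw [Submodule.span_le]
        rintro _ ⟨i, rfl⟩
        exact Submodule.sum_mem _ fun j _ => Submodule.smul_mem _ _ (Submodule.subset_span ⟨j, rfl⟩)
      have : Module.Finite K (Submodule.span K (Set.range w.1)) :=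
        Module.Finite.span_of_finite K (Set.finite_range _)
      have heq := Submodule.eq_of_le_of_finrank_eq hle
        ((finrank_span_eq_card (hli _ hA)).trans (finrank_span_eq_card w.2).symm)
      exact heq
    · rintro ⟨w', hw', h⟩
      have hmem : ∀ i, w' i ∈ Submodule.span K (Set.range w.1) := fun i => by
        have h2 : w' i ∈ Submodule.span K (Set.range w') := Submodule.subset_span ⟨i, rfl⟩
        rwa [h] at h2
      choose A hA using fun i => (Submodule.mem_span_range_iff_exists_fun K).1 (hmem i)
      refine Set.mem_iUnion.2 ⟨A, ?_⟩
      have : T A w.1 = w' := funext hA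
      rw [Set.mem_ofPred_eq, this]
      exact hw'
  · obtain ⟨x, hx⟩ : ∃ x, MvPolynomial.eval x F ≠ 0 := by
      by_contra! hc
      exact hF (MvPolynomial.funext fun x => by simp [hc x])
    let w : Fin r → W := fun i => ∑ k, x (i, k) • bW k
    have hw : w ∈ O := by
      simp only [O, w, Set.mem_ofPred_eq]
      convert hx using 3
      funext y
      simp [Finsupp.single_apply, Finsupp.finsetSum_apply]
    exact ⟨frameSpan K r W ⟨w, hli w hw⟩, w, hw, rfl⟩
  · rintro L ⟨w, hw, hL⟩
    rw [← hL]
    exact hQ w hw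

end General

/-! ### Ranks of multiplication by vectors -/

section Multiplication

variable {K V P : Type*} [Field K] [AddCommGroup V] [Module K V] [AddCommGroup P] [Module K P]
  [Module (ExteriorAlgebra K V) P] [IsScalarTower K (ExteriorAlgebra K V) P]

/-- Multiplication by vectors, as a bilinear map `V → P → P`. -/
noncomputable def extMul (K V P : Type*) [Field K] [AddCommGroup V] [Module K V] [AddCommGroup P]
    [Module K P] [Module (ExteriorAlgebra K V) P] [IsScalarTower K (ExteriorAlgebra K V) P] :
    V →ₗ[K] P →ₗ[K] P :=
  (Algebra.lsmul K K P).toLinearMap ∘ₗ ExteriorAlgebra.ι K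

@[simp]
theorem extMul_apply (v : V) (p : P) : extMul K V P v p = ExteriorAlgebra.ι K v • p := rfl

theorem extMul_extMul (v : V) (p : P) : extMul K V P v (extMul K V P v p) = 0 := by
  rw [extMul_apply, extMul_apply, smul_smul, ExteriorAlgebra.ι_sq_zero, zero_smul]

theorem IsGradedExteriorModule.extMul_mem {𝒢 : ℤ → Submodule K P}
    (h : IsGradedExteriorModule V 𝒢) (v : V) {i : ℤ} {p : P} (hp : p ∈ 𝒢 i) :
    extMul K V P v p ∈ 𝒢 (i + 1) := by
  have h1 : ExteriorAlgebra.ι K v ∈ ⋀[K]^1 V := by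
    change _ ∈ LinearMap.range (ExteriorAlgebra.ι K) ^ 1
    rw [pow_one]
    exact LinearMap.mem_range_self _ v
  have h2 := h.smul_mem 1 i _ p h1 hp
  rwa [Nat.cast_one, add_comm] at h2

theorem finite_of_finite_exteriorAlgebra [Module.Finite K V]
    [Module.Finite (ExteriorAlgebra K V) P] : Module.Finite K P := by
  have : Module.Finite K (ExteriorAlgebra K V) :=
    Module.Finite.of_basis (Module.finBasis K V).ExteriorAlgebra
  exact Module.Finite.trans (ExteriorAlgebra K V) P

theorem alternatingDim_eq_sub {𝒢 : ℤ → Submodule K P} {l : ℤ} (hl : 0 ≤ l) :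
    alternatingDim 𝒢 l = finrank K (𝒢 l) - alternatingDim 𝒢 (l - 1) := by
  have : Finset.Icc 0 l = insert l (Finset.Icc 0 (l - 1)) := by
    ext; simp; omega
  rw [alternatingDim, this, Finset.sum_insert (by simp), alternatingDim, sub_eq_add_neg _
    (Finset.sum _ _), ← Finset.sum_neg_distrib]
  congr 1
  · simp
  · refine Finset.sum_congr rfl fun j _ => ?_
    rw [show l - j = l - 1 - j + 1 by ring, Int.negOnePow_succ]
    simp

/-- Below the top degree, multiplication by a nonzero vector on a graded piece of a faithful module
has rank the alternating sum of dimensions up to that piece. -/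
theorem IsFaithfulExteriorModule.finrank_map_extMul [Module.Finite K P] {𝒢 : ℤ → Submodule K P}
    (hP : IsFaithfulExteriorModule V 𝒢) (hneg : ∀ i < 0, 𝒢 i = ⊥) {l : ℤ} (hl : 𝒢 l ≠ ⊥)
    {v : V} (hv : v ≠ 0) (i : ℕ) (hi : (i : ℤ) - 1 < l) :
    (finrank K ((𝒢 (i - 1)).map (extMul K V P v)) : ℤ) = alternatingDim 𝒢 (i - 1) := by
  -- The shift by one starts the induction in degree `-1`, where both sides vanish.
  induction i with
  | zero =>
    rw [hneg _ (by simp)]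
    simp [alternatingDim]
  | succ i ih =>
    have hi' : ((i + 1 : ℕ) : ℤ) - 1 = i := by omega
    rw [hi'] at hi ⊢
    rw [alternatingDim_eq_sub (by omega), ← ih (by omega)]
    have hrn := LinearMap.finrank_range_add_finrank_ker ((extMul K V P v).domRestrict (𝒢 i))
    have hker : (LinearMap.ker ((extMul K V P v).domRestrict (𝒢 i))).map (𝒢 i).subtype =
        (𝒢 (i - 1)).map (extMul K V P v) := by
      ext p
      constructor
      · rintro ⟨q, hq, rfl⟩
        obtain ⟨q', hq', h⟩ := (hP.exact v hv i ⟨l, by omega, hl⟩ q q.2).1 hq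
        exact ⟨q', hq', h⟩
      · rintro ⟨q, hq, rfl⟩
        have hm := hP.extMul_mem v hq
        rw [sub_add_cancel] at hm
        exact ⟨⟨_, hm⟩, extMul_extMul v q, rfl⟩
    rw [LinearMap.range_domRestrict,
      ← Submodule.finrank_map_subtype_eq (𝒢 i) (LinearMap.ker _), hker] at hrn
    omega

end Multiplication

/-! ### Quotients by subspaces of the top piece -/

section Quotient

variable {K V P : Type*} [Field K] [AddCommGroup V] [Module K V] [AddCommGroup P] [Module K P]
  [Module (ExteriorAlgebra K V) P] [IsScalarTower K (ExteriorAlgebra K V) P]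
  {𝒢 : ℤ → Submodule K P}

theorem mem_quotientGrading_mk {N : Submodule (ExteriorAlgebra K V) P} {i : ℤ} {p : P}
    (hp : p ∈ 𝒢 i) : (Submodule.Quotient.mk p : P ⧸ N) ∈ quotientGrading 𝒢 N i :=
  ⟨p, hp, rfl⟩

/-- The quotient of a graded module by a submodule contained in one graded piece is graded. -/
theorem IsGradedExteriorModule.quotientGrading (h : IsGradedExteriorModule V 𝒢) {l : ℤ}
    {N : Submodule (ExteriorAlgebra K V) P} (hN : ∀ p ∈ N, p ∈ 𝒢 l) :
    IsGradedExteriorModule V (quotientGrading 𝒢 N) where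
  isInternal := by
    obtain ⟨hind, htop⟩ :=
      (DirectSum.isInternal_submodule_iff_iSupIndep_and_iSup_eq_top 𝒢).1 h.isInternal
    rw [DirectSum.isInternal_submodule_iff_iSupIndep_and_iSup_eq_top]
    constructor
    · rw [iSupIndep_def] at hind ⊢
      intro i
      rw [Submodule.disjoint_def]
      rintro _ ⟨a, ha, rfl⟩ hx
      have hle : ⨆ (j) (_ : j ≠ i), _root_.quotientGrading 𝒢 N j =
          (⨆ (j) (_ : j ≠ i), 𝒢 j).map (N.mkQ.restrictScalars K) := by
        rw [Submodule.map_iSup]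
        exact iSup_congr fun j => (Submodule.map_iSup _ _).symm
      rw [hle] at hx
      obtain ⟨b, hb, hab⟩ := hx
      have hc : b - a ∈ N := (Submodule.Quotient.eq N).1 hab
      have hdis := Submodule.disjoint_def.1 (hind i)
      by_cases hi : i = l
      · subst hi
        have hbi : b ∈ 𝒢 i := by simpa using Submodule.add_mem _ (hN _ hc) ha
        rw [← hab, hdis b hbi hb, map_zero]
      · have hcm : b - a ∈ ⨆ (j) (_ : j ≠ i), 𝒢 j :=
          (le_iSup₂_of_le (f := fun j (_ : j ≠ i) => 𝒢 j) l (Ne.symm hi) le_rfl) (hN _ hc)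
        have ham : a ∈ ⨆ (j) (_ : j ≠ i), 𝒢 j := by simpa using Submodule.sub_mem _ hb hcm
        rw [hdis a ha ham, map_zero]
    · refine (Submodule.map_iSup (N.mkQ.restrictScalars K) 𝒢).symm.trans ?_
      rw [htop, Submodule.map_top, LinearMap.range_eq_top]
      exact Submodule.Quotient.mk_surjective N
  smul_mem := by
    rintro a i x _ hx ⟨p, hp, rfl⟩
    exact ⟨x • p, h.smul_mem a i x p hx hp, rfl⟩

/-- The quotient of a faithful module by a subspace of the top piece that meets the image of every
nonzero vector trivially is faithful. -/
theorem IsFaithfulExteriorModule.quotientGrading_pieceSpan (hP : IsFaithfulExteriorModule V 𝒢)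
    {l : ℤ} (hl : IsGreatest {i | 𝒢 i ≠ ⊥} l) (L : Submodule K (𝒢 l))
    (hL : ∀ v : V, v ≠ 0 → ∀ p ∈ L, ∀ q ∈ 𝒢 (l - 1), extMul K V P v q = p → p = 0) :
    IsFaithfulExteriorModule V (quotientGrading 𝒢 (pieceSpan V L)) := by
  have hgr := hP.toIsGradedExteriorModule
  have hmem : ∀ p, p ∈ pieceSpan V L ↔ p ∈ L.map (𝒢 l).subtype := fun p => by
    rw [← restrictScalars_pieceSpan hgr hl, Submodule.restrictScalars_mem]
  have hN : ∀ p ∈ pieceSpan V L, p ∈ 𝒢 l := fun p hp => by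
    obtain ⟨q, -, rfl⟩ := (hmem p).1 hp
    exact q.2
  refine ⟨hgr.quotientGrading hN, ?_⟩
  rintro v hv i ⟨j, hij, hj⟩ _ ⟨p, hp, rfl⟩
  -- The top degree of the quotient can drop but not rise, so exactness of `P` is available at `i`.
  have hjl : j ≤ l := hl.2 fun h0 => hj <| by rw [quotientGrading, h0, Submodule.map_bot]
  constructor
  · intro h
    have hvN : extMul K V P v p ∈ pieceSpan V L :=
      (Submodule.Quotient.mk_eq_zero (pieceSpan V L)).1 h
    have hv0 : ExteriorAlgebra.ι K v • p = 0 := by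
      have hm := hgr.extMul_mem v hp
      -- The hypothesis on `L` is needed only for `i = l - 1`; otherwise `v p` lies in two different
      -- graded pieces.
      by_cases hil : i + 1 = l
      · obtain ⟨q, hq, hqe⟩ := (hmem _).1 hvN
        rw [show i = l - 1 by omega] at hp
        have := hL v hv q hq p hp hqe.symm
        rw [← extMul_apply, ← hqe, this, map_zero]
      · have hind := ((DirectSum.isInternal_submodule_iff_iSupIndep_and_iSup_eq_top 𝒢).1
          hgr.isInternal).1
        exact Submodule.disjoint_def.1 (hind.pairwiseDisjoint hil) _ hm (hN _ hvN)
    obtain ⟨q, hq, hqp⟩ := (hP.exact v hv i ⟨l, by omega, hl.1⟩ p hp).1 hv0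
    exact ⟨_, mem_quotientGrading_mk hq, congrArg (Submodule.Quotient.mk (p := pieceSpan V L)) hqp⟩
  · rintro ⟨_, -, h⟩
    rw [← h, smul_smul, ExteriorAlgebra.ι_sq_zero, zero_smul]

end Quotient

theorem mainTheorem6 {K : Type*} [Field K] [IsAlgClosed K]
    {V : Type*} [AddCommGroup V] [Module K V] (n : ℕ) (hV : Module.finrank K V = n + 1)
    {P : Type*} [AddCommGroup P] [Module K P] [Module (ExteriorAlgebra K V) P]
    [IsScalarTower K (ExteriorAlgebra K V) P] [Module.Finite (ExteriorAlgebra K V) P]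
    (𝒢 : ℤ → Submodule K P) (hneg : ∀ i < 0, 𝒢 i = ⊥)
    (hP : IsFaithfulExteriorModule V 𝒢)
    (l : ℤ) (hl : IsGreatest {i | 𝒢 i ≠ ⊥} l)
    (r : ℕ) (hr : (r : ℤ) ≤ alternatingDim 𝒢 l - n) :
    ForGeneralSubspace K r (𝒢 l) fun L =>
      IsFaithfulExteriorModule V (quotientGrading 𝒢 (pieceSpan V L)) := by
  have : Module.Finite K V := Module.finite_of_finrank_pos (by omega)
  have : Module.Finite K P := finite_of_finite_exteriorAlgebra (V := V)
  have : Infinite K := IsAlgClosed.instInfinite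
  obtain ⟨k, rfl⟩ : ∃ k : ℕ, l = k := Int.eq_ofNat_of_zero_le <| by
    by_contra! h
    exact hl.1 (hneg l h)
  have hgr := hP.toIsGradedExteriorModule
  have hmaps : ∀ v, ∀ q ∈ 𝒢 (k - 1), extMul K V P v q ∈ 𝒢 k := fun v q hq => by
    simpa using hgr.extMul_mem v hq
  let m : V →ₗ[K] 𝒢 (k - 1) →ₗ[K] 𝒢 k := LinearMap.mk₂ K
    (fun v q => ⟨extMul K V P v q, hmaps v q q.2⟩)
    (fun _ _ _ => Subtype.ext (by simp)) (fun _ _ _ => Subtype.ext (by simp))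
    (fun _ _ _ => Subtype.ext (by simp)) (fun _ _ _ => Subtype.ext (by simp))
  have hrange : ∀ v, v ≠ 0 →
      (finrank K (LinearMap.range (m v)) : ℤ) = alternatingDim 𝒢 (k - 1) := fun v hv => by
    rw [← hP.finrank_map_extMul hneg hl.1 hv k (by omega), ← Submodule.finrank_map_subtype_eq]
    have : (LinearMap.range (m v)).map (𝒢 k).subtype = (𝒢 (k - 1)).map (extMul K V P v) := by
      ext p
      constructor
      · rintro ⟨_, ⟨q, rfl⟩, rfl⟩
        exact ⟨q, q.2, rfl⟩
      · rintro ⟨q, hq, rfl⟩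
        exact ⟨_, ⟨⟨q, hq⟩, rfl⟩, rfl⟩
    rw [this]
  have hχ : alternatingDim 𝒢 k = finrank K (𝒢 k) - alternatingDim 𝒢 (k - 1) :=
    alternatingDim_eq_sub (by omega)
  have bV : Basis (Fin (n + 1)) K V := Module.finBasisOfFinrankEq K V hV
  obtain ⟨s, hs⟩ : ∃ s : ℕ, (s : ℤ) = alternatingDim 𝒢 (k - 1) :=
    ⟨_, hrange _ (bV.ne_zero 0)⟩
  let bW := Module.finBasis K (𝒢 k)
  -- By `hχ`, the required `n + r + s ≤ dim P_l` is `hr`.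
  obtain ⟨F, hF0, hF⟩ := exists_polynomial_of_rank (r := r) (s := s) m bV bW
    (by rw [Fintype.card_fin]; omega) (fun v hv => by have := hrange v hv; omega)
  refine ForGeneralSubspace.of_polynomial bW F hF0 _ (fun w hw => ?_) fun w hw => ?_
  -- Dependent tuples are bad too: a vanishing combination lies in the image of any nonzero vector.
  · rw [Fintype.linearIndependent_iff]
    intro a ha
    by_contra! hne
    refine hw (hF w (bV 0) a (bV.ne_zero 0) (fun h0 => ?_) (ha ▸ Submodule.zero_mem _))
    simp [h0] at hne
  · refine hP.quotientGrading_pieceSpan hl _ fun v hv p hp q hq h => ?_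
    obtain ⟨a, rfl⟩ := (Submodule.mem_span_range_iff_exists_fun K).1 hp
    by_contra hne
    refine hw (hF w v a hv (fun h0 => hne (by simp [h0])) ⟨⟨q, hq⟩, Subtype.ext h⟩)
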